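/- Let $\Sigma$ be a finite alphabet and let $\$\notin\Sigma$ be an end-marker. A measure-many quantum finite automaton (MM-QFA) over $\Sigma$ consists of a finite set of states $Q$, a unitary matrix $U_\sigma\in\mathbb{C}^{Q\times Q}$ for each $\sigma\in\Sigma\cup\{\$\}$, an initial state $q_0\in Q$, and disjoint sets $Q_{acc},Q_{rej}\subseteq Q$ of accepting and rejecting halting states; put $Q_{non}=Q\setminus(Q_{acc}\cup Q_{rej})$, and let $P_{acc},P_{rej},P_{non}$ be the orthogonal projections of $\mathbb{C}^Q$ onto the spans of the corresponding basis vectors. The automaton starts in $(|q_0\rangle,0,0)$, and reading a symbol $\sigma$ changes $(\psi,p_{acc},p_{rej})$ into $$\bigl(P_{non}U_\sigma\psi,\ p_{acc}+\|P_{acc}U_\sigma\psi\|^2,\ p_{rej}+\|P_{rej}U_\sigma\psi\|^2\bigr).$$ The probability $p_M(x)$ that $M$ accepts $x\in\Sigma^*$ is the value of $p_{acc}$ after reading $x\$$. The automaton $M$ is end-decisive if it is never observed in an accepting state before the end-marker is read, i.e. for every $x\in\Sigma^*$ the value of $p_{acc}$ after reading $x$ (without $\$$) is $0$. It accepts a language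 $L\subseteq\Sigma^*$ with bounded error if there are a cut-point $\lambda\in[0,1]$ and a margin $\epsilon>0$ such that $p_M(x)>\lambda+\epsilon$ for all $x\in L$ and $p_M(x)<\lambda-\epsilon$ for all $x\in\Sigma^*\setminus L$. A language over $\Sigma$ is piecewise testable if it is a finite Boolean combination of languages of the form $\Sigma^*z_1\Sigma^*z_2\Sigma^*\cdots\Sigma^*z_n\Sigma^*$ with $n\ge 0$ and $z_1,\dots,z_n\in\Sigma$. **Theorem.** For every piecewise testable language $L\subseteq\Sigma^*$ there is an end-decisive MM-QFA that accepts $L$ with bounded error. -/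

import Mathlib

open scoped Matrix

noncomputable section

/-- The language `Σ*` of all words over the alphabet `α`. -/
def allWords (α : Type*) : Language α := (Set.univ : Set (List α))

/-- The language `L_z = Σ* z₁ Σ* z₂ Σ* ⋯ Σ* zₙ Σ*` of a word `z = z₁z₂⋯zₙ`
(so `L_z = Σ*` for the empty word `z`). -/
def subseqLanguage {α : Type*} : List α → Language α
  | [] => allWords α
  | a :: z => allWords α * ({[a]} : Language α) * subseqLanguage z

/-- A language is piecewise testable if it is a (finite) Boolean combination of languages
of the form `Σ* z₁ Σ* ⋯ Σ* zₙ Σ*`. -/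
inductive IsPiecewiseTestable {α : Type*} : Set (List α) → Prop
  | subseq (z : List α) : IsPiecewiseTestable (subseqLanguage z)
  | compl {L : Set (List α)} : IsPiecewiseTestable L → IsPiecewiseTestable Lᶜ
  | union {L L' : Set (List α)} :
      IsPiecewiseTestable L → IsPiecewiseTestable L' → IsPiecewiseTestable (L ∪ L')
  | inter {L L' : Set (List α)} :
      IsPiecewiseTestable L → IsPiecewiseTestable L' → IsPiecewiseTestable (L ∩ L')

/-- A measure-many quantum finite automaton with input alphabet `α` and finite state set `Q`.
The tape alphabet is `Option α`: `some σ` is the input symbol `σ` and `none` is the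
end-marker `$`. -/
structure MMQFA (α : Type*) (Q : Type*) [Fintype Q] [DecidableEq Q] where
  /-- The unitary matrix of each tape symbol. Configurations are column vectors, so the
  amplitude `δ(q, σ, q')` flowing from `q` to `q'` is the entry `U σ q' q`. -/
  U : Option α → Matrix.unitaryGroup Q ℂ
  /-- The initial state. -/
  q₀ : Q
  /-- The halting accepting states. -/
  acc : Finset Q
  /-- The halting rejecting states. -/
  rej : Finset Q
  disjoint_acc_rej : Disjoint acc rej

namespace MMQFA

variable {α Q : Type*} [Fintype Q] [DecidableEq Q]

/-- The non-halting states: all states that are neither accepting nor rejecting. -/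
def non (M : MMQFA α Q) : Finset Q := (M.acc ∪ M.rej)ᶜ

/-- The orthogonal projection of `ψ` onto the span of the basis vectors indexed by `S`. -/
def proj (S : Finset Q) (ψ : Q → ℂ) : Q → ℂ := fun q => if q ∈ S then ψ q else 0

/-- The squared Euclidean norm of `ψ`. -/
def sqNorm (ψ : Q → ℂ) : ℝ := ∑ q, ‖ψ q‖ ^ 2

/-- The total state `(|ψ⟩, p_acc, p_rej)` of a computation: the (unnormalized) non-halting
configuration and the cumulative probabilities of having accepted and rejected. -/
structure Config (Q : Type*) where
  ψ : Q → ℂ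
  pAcc : ℝ
  pRej : ℝ

/-- The total state before any symbol is read: `(|q₀⟩, 0, 0)`. -/
def init (M : MMQFA α Q) : Config Q := ⟨Pi.single M.q₀ 1, 0, 0⟩

/-- Reading one tape symbol: apply `U σ`, then measure with respect to the accepting,
rejecting and non-halting subspaces. -/
def step (M : MMQFA α Q) (c : Config Q) (σ : Option α) : Config Q :=
  let ψ' : Q → ℂ := (M.U σ : Matrix Q Q ℂ) *ᵥ c.ψ
  ⟨proj M.non ψ', c.pAcc + sqNorm (proj M.acc ψ'), c.pRej + sqNorm (proj M.rej ψ')⟩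

/-- The total state after reading a string of tape symbols from left to right. -/
def run (M : MMQFA α Q) (w : List (Option α)) : Config Q := w.foldl M.step M.init

/-- The probability that `M` accepts the input `x`, i.e. accepts while reading `x$`. -/
def acceptProb (M : MMQFA α Q) (x : List α) : ℝ := (M.run (x.map some ++ [none])).pAcc

/-- `M` is end-decisive: it is never observed in an accepting state before the end-marker is
read, i.e. for every input the probability of having accepted before reading `$` is zero. -/
def EndDecisive (M : MMQFA α Q) : Prop := ∀ x : List α, (M.run (x.map some)).pAcc = 0

/-- `M` accepts `L` with bounded error: for some cut-point `c` and some margin `ε > 0`, words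
in `L` are accepted with probability greater than `c + ε` and all other words with
probability less than `c - ε`. -/
def AcceptsWithBoundedError (M : MMQFA α Q) (L : Set (List α)) : Prop :=
  ∃ c ∈ Set.Icc (0 : ℝ) 1, ∃ ε : ℝ, 0 < ε ∧
    (∀ x ∈ L, c + ε < M.acceptProb x) ∧ (∀ x ∉ L, M.acceptProb x < c - ε)

end MMQFA

end

/-! A doubly stochastic matrix contracts the Euclidean norm, so it is a block of an orthogonal
matrix. A QFA can thus carry the distribution of a doubly stochastic chain as its amplitudes,
leaking the lost norm into rejecting states. The end-marker sends the inner product with a reward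
vector into an accepting state, so the acceptance probability is the squared expected reward, up to
scaling (`exists_endDecisive_acceptProb_eq`).

Expected rewards are closed under sums and products, so it suffices to approximate indicators of
piecewise testable languages uniformly by them. For the subsequence language of `z`, a walk on the
positions of `z` tries a random adjacent transposition whose letter matches the input. It can reach
the end only if `z` is a subsequence, and then does so with probability bounded below independently
of the input (`exists_threshold_expectedReward`). The polynomial `1 - (1 - f)^m` amplifies this
bound, and Boolean operations become `1 - f` and `f * g`. -/

theorem mem_subseqLanguage_iff {α : Type*} (z w : List α) :
    w ∈ subseqLanguage z ↔ z.Sublist w := by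
  induction z generalizing w with
  | nil => exact iff_of_true (Set.mem_univ w) (List.nil_sublist w)
  | cons a z ih =>
    rw [List.cons_sublist_iff, subseqLanguage]
    constructor
    · rintro ⟨_, ⟨x, -, _, rfl, rfl⟩, y, hy, rfl⟩
      exact ⟨x ++ [a], y, rfl, by simp, (ih y).1 hy⟩
    · rintro ⟨r₁, r₂, rfl, ha, hr⟩
      obtain ⟨s, t, rfl⟩ := List.append_of_mem ha
      refine ⟨s ++ [a], ⟨s, Set.mem_univ s, [a], rfl, rfl⟩, t ++ r₂,
        (ih _).2 (hr.trans (List.sublist_append_right t r₂)), by simp⟩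

/-! ### Expected rewards of doubly stochastic chains -/

/-- The expected reward of a Markov chain driven by a word: the value at `s` is the expectation
of `c` at the final state when the chain starts in `s`. -/
def expectedReward {α S : Type*} [Fintype S] (A : α → Matrix S S ℝ) (c : S → ℝ) :
    List α → S → ℝ
  | [] => c
  | σ :: w => A σ *ᵥ expectedReward A c w

/-- Functions on words that are the expected reward of a doubly stochastic Markov chain with
finitely many states and a fixed initial state. -/
def IsRewardFunction {α : Type*} (f : List α → ℝ) : Prop :=
  ∃ (S : Type) (_ : Fintype S) (_ : DecidableEq S) (A : α → Matrix S S ℝ) (c : S → ℝ) (s : S),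
    (∀ σ, A σ ∈ doublyStochastic ℝ S) ∧ ∀ w, f w = expectedReward A c w s

section Reward

variable {α S T : Type*} [Fintype S] [Fintype T]

theorem expectedReward_add (A : α → Matrix S S ℝ) (c d : S → ℝ) (w : List α) :
    expectedReward A (c + d) w = expectedReward A c w + expectedReward A d w := by
  induction w with
  | nil => rfl
  | cons σ w ih => simp [expectedReward, ih, Matrix.mulVec_add]

theorem expectedReward_smul (A : α → Matrix S S ℝ) (r : ℝ) (c : S → ℝ) (w : List α) :
    expectedReward A (r • c) w = r • expectedReward A c w := by
  induction w with
  | nil => rfl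
  | cons σ w ih => simp [expectedReward, ih, Matrix.mulVec_smul]

theorem expectedReward_one [DecidableEq S] (A : α → Matrix S S ℝ)
    (hA : ∀ σ, A σ ∈ doublyStochastic ℝ S) (w : List α) :
    expectedReward A 1 w = 1 := by
  induction w with
  | nil => rfl
  | cons σ w ih => simp [expectedReward, ih, mulVec_one_of_mem_doublyStochastic (hA σ)]

theorem expectedReward_mono [DecidableEq S] (A : α → Matrix S S ℝ)
    (hA : ∀ σ, A σ ∈ doublyStochastic ℝ S) {c d : S → ℝ} (h : c ≤ d) (w : List α) :
    expectedReward A c w ≤ expectedReward A d w := by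
  induction w with
  | nil => exact h
  | cons σ w ih =>
    intro i
    exact Finset.sum_le_sum fun j _ => mul_le_mul_of_nonneg_left (ih j) ((hA σ).1 i j)

-- Two chains run independently on the same word, so the expectation of a product reward factors.
open scoped Kronecker in
theorem expectedReward_kronecker (A : α → Matrix S S ℝ) (B : α → Matrix T T ℝ)
    (c : S → ℝ) (d : T → ℝ) (w : List α) (p : S × T) :
    expectedReward (fun σ => A σ ⊗ₖ B σ) (fun p => c p.1 * d p.2) w p =
      expectedReward A c w p.1 * expectedReward B d w p.2 := by
  induction w generalizing p with
  | nil => rfl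
  | cons σ w ih =>
    simp only [expectedReward, Matrix.mulVec, dotProduct, Fintype.sum_prod_type, ih,
      Finset.sum_mul_sum, Matrix.kroneckerMap_apply]
    exact Finset.sum_congr rfl fun i _ => Finset.sum_congr rfl fun j _ => by ring

open scoped Kronecker in
theorem kronecker_mem_doublyStochastic [DecidableEq S] [DecidableEq T]
    {A : Matrix S S ℝ} {B : Matrix T T ℝ} (hA : A ∈ doublyStochastic ℝ S)
    (hB : B ∈ doublyStochastic ℝ T) : A ⊗ₖ B ∈ doublyStochastic ℝ (S × T) := by
  rw [mem_doublyStochastic_iff_sum] at *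
  refine ⟨fun i j => mul_nonneg (hA.1 _ _) (hB.1 _ _), fun i => ?_, fun j => ?_⟩
  · simp [Fintype.sum_prod_type, ← Finset.mul_sum, hA.2.1, hB.2.1]
  · simp [Fintype.sum_prod_type, ← Finset.mul_sum, hA.2.2, hB.2.2]

end Reward

namespace IsRewardFunction

variable {α : Type*} {f g : List α → ℝ}

theorem const (r : ℝ) : IsRewardFunction fun _ : List α => r := by
  refine ⟨Unit, inferInstance, inferInstance, fun _ => 1, fun _ => r, (),
    fun _ => one_mem _, fun w => ?_⟩
  induction w with
  | nil => rfl
  | cons σ w ih => simpa [expectedReward] using ih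

theorem const_mul (r : ℝ) (hf : IsRewardFunction f) : IsRewardFunction fun w => r * f w := by
  obtain ⟨S, _, _, A, c, s, hA, hf⟩ := hf
  exact ⟨S, _, _, A, r • c, s, hA, fun w => by simp [expectedReward_smul, hf]⟩

theorem mul (hf : IsRewardFunction f) (hg : IsRewardFunction g) :
    IsRewardFunction fun w => f w * g w := by
  obtain ⟨S, _, _, A, c, s, hA, hf⟩ := hf
  obtain ⟨T, _, _, B, d, t, hB, hg⟩ := hg
  exact ⟨S × T, inferInstance, inferInstance, _, _, (s, t),
    fun σ => kronecker_mem_doublyStochastic (hA σ) (hB σ),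
    fun w => by rw [expectedReward_kronecker, ← hf, ← hg]⟩

theorem add (hf : IsRewardFunction f) (hg : IsRewardFunction g) :
    IsRewardFunction fun w => f w + g w := by
  obtain ⟨S, _, _, A, c, s, hA, hf⟩ := hf
  obtain ⟨T, _, _, B, d, t, hB, hg⟩ := hg
  refine ⟨S × T, inferInstance, inferInstance, _,
    -- Padding each summand with the constant reward 1 makes it a product reward on the product
    -- chain.
    (fun p => c p.1 * (1 : T → ℝ) p.2) + fun p => (1 : S → ℝ) p.1 * d p.2, (s, t),
    fun σ => kronecker_mem_doublyStochastic (hA σ) (hB σ), fun w => ?_⟩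
  rw [expectedReward_add, Pi.add_apply, expectedReward_kronecker, expectedReward_kronecker,
    expectedReward_one A hA, expectedReward_one B hB, ← hf, ← hg]
  simp

theorem one_sub (hf : IsRewardFunction f) : IsRewardFunction fun w => 1 - f w := by
  simpa [sub_eq_add_neg] using (const 1).add (hf.const_mul (-1))

theorem pow (hf : IsRewardFunction f) (m : ℕ) : IsRewardFunction fun w => f w ^ m := by
  induction m with
  | zero => simpa using const 1
  | succ m ih => simpa [pow_succ] using ih.mul hf

end IsRewardFunction

/-! ### The random walk detecting a subsequence -/

section Chain

variable {α : Type*}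

open Classical in
/-- The transposition of the positions `k` and `k + 1` if the letter `z k` is `σ`, and the
identity otherwise. -/
noncomputable def advancePerm {n : ℕ} (z : Fin n → α) (σ : α) (k : Fin n) :
    Equiv.Perm (Fin (n + 1)) :=
  if z k = σ then Equiv.swap k.castSucc k.succ else 1

/-- The average of the identity and of the transpositions that match the letter `σ`. -/
noncomputable def advanceMatrix {n : ℕ} (z : Fin n → α) (σ : α) :
    Matrix (Fin (n + 1)) (Fin (n + 1)) ℝ :=
  ((n : ℝ) + 1)⁻¹ • (1 + ∑ k, (advancePerm z σ k).permMatrix ℝ)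

theorem advanceMatrix_mem_doublyStochastic {n : ℕ} (z : Fin n → α) (σ : α) :
    advanceMatrix z σ ∈ doublyStochastic ℝ (Fin (n + 1)) := by
  have hn : ((n : ℝ) + 1) ≠ 0 := by positivity
  rw [mem_doublyStochastic]
  refine ⟨fun i j => ?_, ?_, ?_⟩
  · simp only [advanceMatrix, Matrix.smul_apply, Matrix.add_apply, Matrix.sum_apply, smul_eq_mul]
    refine mul_nonneg (by positivity) (add_nonneg
      (nonneg_of_mem_doublyStochastic (one_mem (doublyStochastic ℝ _)))
      (Finset.sum_nonneg fun k _ => permMatrix_mem_doublyStochastic.1 i j))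
  · simp only [advanceMatrix, Matrix.smul_mulVec, Matrix.add_mulVec, Matrix.sum_mulVec,
      Matrix.one_mulVec,
      mulVec_one_of_mem_doublyStochastic permMatrix_mem_doublyStochastic]
    ext i
    simp
    field_simp
    ring
  · simp only [advanceMatrix, Matrix.vecMul_smul, Matrix.vecMul_add, Matrix.vecMul_sum,
      Matrix.vecMul_one,
      one_vecMul_of_mem_doublyStochastic permMatrix_mem_doublyStochastic]
    ext i
    simp
    field_simp
    ring

theorem advanceMatrix_mulVec {n : ℕ} (z : Fin n → α) (σ : α) (u : Fin (n + 1) → ℝ)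
    (i : Fin (n + 1)) :
    (advanceMatrix z σ *ᵥ u) i =
      ((n : ℝ) + 1)⁻¹ * (u i + ∑ k, u (advancePerm z σ k i)) := by
  simp [advanceMatrix, Matrix.smul_mulVec, Matrix.add_mulVec, Matrix.sum_mulVec,
    Matrix.permMatrix_mulVec, mul_add]

theorem val_advancePerm {n : ℕ} (z : Fin n → α) (σ : α) (k : Fin n) (i : Fin (n + 1)) :
    ((advancePerm z σ k i : Fin (n + 1)) : ℕ) = i ∨
      z k = σ ∧ ((i : ℕ) = k ∧ (advancePerm z σ k i : ℕ) = k + 1 ∨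
        (i : ℕ) = k + 1 ∧ (advancePerm z σ k i : ℕ) = k) := by
  unfold advancePerm
  split_ifs with h
  · rw [Equiv.swap_apply_def]
    split_ifs with h1 h2
    · exact Or.inr ⟨h, Or.inl ⟨by simp [h1], by simp⟩⟩
    · exact Or.inr ⟨h, Or.inr ⟨by simp [h2], by simp⟩⟩
    · exact Or.inl rfl
  · exact Or.inl rfl

theorem drop_sublist_cons_iff (z : List α) (σ : α) (w : List α) {i : ℕ} (hi : i < z.length) :
    (z.drop i).Sublist (σ :: w) ↔
      (z.drop i).Sublist w ∨ z[i] = σ ∧ (z.drop (i + 1)).Sublist w := by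
  rw [List.sublist_cons_iff]
  refine or_congr_right ?_
  rw [List.drop_eq_getElem_cons hi]
  constructor
  · rintro ⟨r, h, hr⟩
    obtain ⟨h1, rfl⟩ := List.cons.inj h
    exact ⟨h1, hr⟩
  · rintro ⟨h, hr⟩
    exact ⟨_, by rw [h], hr⟩

/-- The threshold `s` is the least start of a suffix of `z` embedding in `w`. Prepending a letter
averages the values over moves. No move crosses the threshold unless the letter is `z[s-1]`; then
`s` drops by one and the lower bound loses one factor `δ`. This happens at most `z.length` times,
however long `w` is. -/
theorem exists_threshold_expectedReward (z w : List α) :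
    ∃ s ≤ z.length, (∀ i ≤ z.length, (z.drop i).Sublist w ↔ s ≤ i) ∧
      (∀ i : Fin (z.length + 1), s ≤ i →
        (((z.length : ℝ) + 1)⁻¹) ^ (z.length - s) ≤
          expectedReward (advanceMatrix z.get) (Pi.single (Fin.last _) 1) w i) ∧
      ∀ i : Fin (z.length + 1), (i : ℕ) < s →
        expectedReward (advanceMatrix z.get) (Pi.single (Fin.last _) 1) w i = 0 := by
  have hn : (0 : ℝ) < (z.length : ℝ) + 1 := by positivity
  induction w with
  | nil =>
    refine ⟨z.length, le_rfl, fun i hi => ?_, fun i hi => ?_, fun i hi => ?_⟩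
    · simp
    · have : i = Fin.last _ := Fin.ext (by have := i.2; simp; omega)
      simp [expectedReward, this]
    · have : i ≠ Fin.last _ := by rintro rfl; simp at hi
      simp [expectedReward, this]
  | cons σ w ih =>
    obtain ⟨s, hs, hsub, hlow, hzero⟩ := ih
    set u := expectedReward (advanceMatrix z.get) (Pi.single (Fin.last _) 1) w with hu
    set δ : ℝ := ((z.length : ℝ) + 1)⁻¹ with hδ
    have hδ0 : 0 < δ := inv_pos.2 hn
    have hu0 : ∀ i, 0 ≤ u i := fun i => by
      rcases lt_or_ge (i : ℕ) s with h | h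
      · exact (hzero i h).ge
      · exact le_trans (by positivity) (hlow i h)
    have hstep : ∀ i, expectedReward (advanceMatrix z.get) (Pi.single (Fin.last _) 1) (σ :: w) i =
        δ * (u i + ∑ k, u (advancePerm z.get σ k i)) := fun i => advanceMatrix_mulVec _ _ _ _
    have hsub' : ∀ i ≤ z.length, (z.drop i).Sublist (σ :: w) ↔
        s ≤ i ∨ ∃ h : i < z.length, z[i] = σ ∧ s ≤ i + 1 := by
      intro i hi
      rcases hi.eq_or_lt with rfl | hi'
      · simp [hs]
      · rw [drop_sublist_cons_iff z σ w hi', hsub i hi, hsub (i + 1) hi']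
        simp [hi']
    by_cases hmatch : ∃ t, ∃ h : t < z.length, s = t + 1 ∧ z[t] = σ
    · obtain ⟨t, ht, rfl, hσ⟩ := hmatch
      have hpow : δ ^ (z.length - t) = δ * δ ^ (z.length - (t + 1)) := by
        rw [← pow_succ']; congr 1; omega
      refine ⟨t, ht.le, fun i hi => ?_, fun i hi => ?_, fun i hi => ?_⟩
      · rw [hsub' i hi]
        constructor
        · rintro (h | ⟨-, -, h⟩) <;> omega
        · intro h
          rcases h.eq_or_lt with rfl | h
          · exact Or.inr ⟨ht, hσ, le_rfl⟩
          · exact Or.inl h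
      · rw [hstep, hpow]
        refine mul_le_mul_of_nonneg_left ?_ hδ0.le
        have hsum := Finset.sum_nonneg fun (k : Fin z.length) (_ : k ∈ Finset.univ) =>
          hu0 (advancePerm z.get σ k i)
        -- One good summand suffices: at the new threshold the transposition to `t + 1`, above it
        -- the identity.
        rcases hi.eq_or_lt with h | h
        · have h1 : ((advancePerm z.get σ ⟨t, ht⟩ i : Fin _) : ℕ) = t + 1 := by
            have : i = Fin.castSucc ⟨t, ht⟩ := Fin.ext h.symm
            simp [advancePerm, hσ, this]
          have h2 := Finset.single_le_sum (f := fun k => u (advancePerm z.get σ k i))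
            (fun k _ => hu0 _) (Finset.mem_univ (⟨t, ht⟩ : Fin z.length))
          linarith [hlow _ h1.ge, hu0 i]
        · linarith [hlow i h]
      · rw [hstep, hzero i (by omega), Finset.sum_eq_zero, add_zero, mul_zero]
        intro k _
        apply hzero
        rcases val_advancePerm z.get σ k i with h | ⟨-, ⟨h, h'⟩ | ⟨h, h'⟩⟩ <;> omega
    · refine ⟨s, hs, fun i hi => ?_, fun i hi => ?_, fun i hi => ?_⟩
      · rw [hsub' i hi]
        refine ⟨?_, Or.inl⟩
        rintro (h | ⟨hi', h, h'⟩)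
        · exact h
        · by_contra hlt
          exact hmatch ⟨i, hi', by omega, h⟩
      · rw [hstep]
        -- Without a match no transposition leads from `i ≥ s` to below `s`, so all terms of the
        -- average obey the old bound.
        have h1 : ∀ k ∈ Finset.univ, δ ^ (z.length - s) ≤ u (advancePerm z.get σ k i) := by
          intro k _
          apply hlow
          rcases val_advancePerm z.get σ k i with h | ⟨hk, ⟨h, h'⟩ | ⟨h, h'⟩⟩
          · omega
          · omega
          · by_contra hlt
            exact hmatch ⟨k, k.2, by omega, hk⟩
        have h2 := Finset.card_nsmul_le_sum _ _ _ h1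
        rw [Finset.card_univ, Fintype.card_fin, nsmul_eq_mul] at h2
        calc δ ^ (z.length - s) = δ * (δ ^ (z.length - s) + z.length * δ ^ (z.length - s)) := by
              rw [hδ]; field_simp; ring
          _ ≤ _ := mul_le_mul_of_nonneg_left (add_le_add (hlow i hi) h2) hδ0.le
      · rw [hstep, hzero i hi, Finset.sum_eq_zero, add_zero, mul_zero]
        intro k _
        apply hzero
        rcases val_advancePerm z.get σ k i with h | ⟨hk, ⟨h, h'⟩ | ⟨h, h'⟩⟩
        · omega
        · by_contra hlt
          exact hmatch ⟨k, k.2, by omega, hk⟩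
        · omega

/-- Some reward function with values in `[0, 1]` vanishes outside the language of `z` and is
bounded away from zero on it. -/
theorem exists_isRewardFunction_subseq (z : List α) :
    ∃ f : List α → ℝ, IsRewardFunction f ∧ (∀ w, f w ≤ 1) ∧ ∃ δ : ℝ, 0 < δ ∧
      (∀ w, z.Sublist w → δ ≤ f w) ∧ ∀ w, ¬ z.Sublist w → f w = 0 := by
  refine ⟨fun w => expectedReward (advanceMatrix z.get) (Pi.single (Fin.last _) 1) w 0,
    ⟨_, inferInstance, inferInstance, _, _, _, advanceMatrix_mem_doublyStochastic z.get,
      fun w => rfl⟩, fun w => ?_, (((z.length : ℝ) + 1)⁻¹) ^ z.length, by positivity,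
    fun w hw => ?_, fun w hw => ?_⟩
  · have h : (Pi.single (Fin.last z.length) 1 : Fin (z.length + 1) → ℝ) ≤ 1 := by
      intro i
      by_cases hi : i = Fin.last _ <;> simp [hi]
    have := expectedReward_mono _ (advanceMatrix_mem_doublyStochastic z.get) h w 0
    rwa [expectedReward_one _ (advanceMatrix_mem_doublyStochastic z.get)] at this
  · obtain ⟨s, -, hsub, hlow, -⟩ := exists_threshold_expectedReward z w
    obtain rfl : s = 0 := by simpa using (hsub 0 (Nat.zero_le _)).1 (by simpa using hw)
    simpa using hlow 0 le_rfl
  · obtain ⟨s, -, hsub, -, hzero⟩ := exists_threshold_expectedReward z w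
    refine hzero 0 (Nat.pos_of_ne_zero fun hs => hw ?_)
    simpa using (hsub 0 (Nat.zero_le _)).2 hs.le

end Chain

/-! ### Uniform approximation of indicators -/

open Classical in
/-- The indicator function of the language is a uniform limit of reward functions. -/
def IsRewardApproximable {α : Type*} (L : Set (List α)) : Prop :=
  ∀ ε : ℝ, 0 < ε → ∃ f : List α → ℝ, IsRewardFunction f ∧
    ∀ w, |f w - if w ∈ L then 1 else 0| ≤ ε

namespace IsRewardApproximable

variable {α : Type*} {L L' : Set (List α)}

theorem compl (hL : IsRewardApproximable L) : IsRewardApproximable Lᶜ := by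
  intro ε hε
  obtain ⟨f, hf, h⟩ := hL ε hε
  refine ⟨_, hf.one_sub, fun w => ?_⟩
  have := abs_le.1 (h w)
  rw [abs_le]
  by_cases hw : w ∈ L <;> simp [hw] at this ⊢ <;> constructor <;> linarith

theorem inter (hL : IsRewardApproximable L) (hL' : IsRewardApproximable L') :
    IsRewardApproximable (L ∩ L') := by
  intro ε hε
  -- The product of two `η`-approximations is off by at most `2η + η² ≤ 3η`.
  obtain ⟨η, hη, hη1, hηε⟩ : ∃ η : ℝ, 0 < η ∧ η ≤ 1 ∧ 3 * η ≤ ε :=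
    ⟨min 1 (ε / 3), by positivity, min_le_left _ _, by linarith [min_le_right 1 (ε / 3)]⟩
  obtain ⟨f, hf, h⟩ := hL η hη
  obtain ⟨g, hg, h'⟩ := hL' η hη
  refine ⟨_, hf.mul hg, fun w => ?_⟩
  have h1 := abs_le.1 (h w)
  have h2 := abs_le.1 (h' w)
  rw [abs_le]
  by_cases hw : w ∈ L <;> by_cases hw' : w ∈ L' <;> simp [hw, hw'] at h1 h2 ⊢ <;>
    constructor <;> nlinarith

theorem union (hL : IsRewardApproximable L) (hL' : IsRewardApproximable L') :
    IsRewardApproximable (L ∪ L') := by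
  simpa [Set.compl_inter] using (hL.compl.inter hL'.compl).compl

theorem sublist (z : List α) : IsRewardApproximable {w | z.Sublist w} := by
  intro ε hε
  obtain ⟨f, hf, hf1, δ, hδ, hlow, hzero⟩ := exists_isRewardFunction_subseq z
  have hδ1 : δ ≤ 1 := (hlow z (List.Sublist.refl z)).trans (hf1 z)
  obtain ⟨m, hm⟩ := exists_pow_lt_of_lt_one hε (sub_lt_self 1 hδ)
  refine ⟨_, (hf.one_sub.pow m).one_sub, fun w => ?_⟩
  by_cases hw : z.Sublist w
  · have h1 : (1 - f w) ^ m ≤ (1 - δ) ^ m :=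
      pow_le_pow_left₀ (by linarith [hf1 w]) (by linarith [hlow w hw]) m
    have h2 : 0 ≤ (1 - f w) ^ m := pow_nonneg (by linarith [hf1 w]) m
    rw [if_pos (show w ∈ {w | z.Sublist w} from hw), abs_le]
    constructor <;> linarith
  · rw [if_neg (show w ∉ {w | z.Sublist w} from hw), hzero w hw]
    simpa using hε.le

end IsRewardApproximable

theorem IsPiecewiseTestable.isRewardApproximable {α : Type*} {L : Set (List α)}
    (hL : IsPiecewiseTestable L) : IsRewardApproximable L := by
  induction hL with
  | subseq z =>
    have h : {w | z.Sublist w} = (subseqLanguage z : Set (List α)) :=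
      Set.ext fun w => (mem_subseqLanguage_iff z w).symm
    exact h ▸ .sublist z
  | compl _ ih => exact ih.compl
  | union _ _ ih ih' => exact ih.union ih'
  | inter _ _ ih ih' => exact ih.inter ih'

/-! ### Contractions as blocks of orthogonal matrices -/

section Dilation

variable {n : Type*}

/-- Cauchy–Schwarz with row sums 1 bounds each squared entry by an average of squares; column sums 1
bound the total. -/
theorem dotProduct_mulVec_self_le_of_mem_doublyStochastic [Fintype n] [DecidableEq n]
    {A : Matrix n n ℝ} (hA : A ∈ doublyStochastic ℝ n) (x : n → ℝ) :
    (A *ᵥ x) ⬝ᵥ (A *ᵥ x) ≤ x ⬝ᵥ x := by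
  have hrow : ∀ i, (A *ᵥ x) i * (A *ᵥ x) i ≤ ∑ j, A i j * (x j * x j) := by
    intro i
    have h := Finset.sum_sq_le_sum_mul_sum_of_sq_le_mul Finset.univ
      (r := fun j => A i j * x j) (f := fun j => A i j) (g := fun j => A i j * (x j * x j))
      (fun j _ => hA.1 i j) (fun j _ => mul_nonneg (hA.1 i j) (mul_self_nonneg _))
      (fun j _ => le_of_eq (by ring))
    rw [sum_row_of_mem_doublyStochastic hA, one_mul, sq] at h
    exact h
  calc (A *ᵥ x) ⬝ᵥ (A *ᵥ x) ≤ ∑ i, ∑ j, A i j * (x j * x j) :=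
        Finset.sum_le_sum fun i _ => hrow i
    _ = x ⬝ᵥ x := by
        rw [Finset.sum_comm]
        exact Finset.sum_congr rfl fun j _ => by
          rw [← Finset.sum_mul, sum_col_of_mem_doublyStochastic hA, one_mul]

theorem exists_orthogonal_extension_of_isometry {m : Type*} [Fintype m] [DecidableEq m]
    [DecidableEq n] (e : n ↪ m) (V : Matrix m n ℝ) (hV : Vᵀ * V = 1) :
    ∃ U ∈ Matrix.orthogonalGroup m ℝ, ∀ q j, U q (e j) = V q j := by
  let v : m → EuclideanSpace ℝ m := Function.extend e (fun j => WithLp.toLp 2 fun q => V q j) 0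
  have hv : ∀ j, v (e j) = WithLp.toLp 2 fun q => V q j := fun j => e.injective.extend_apply _ _ j
  have hon : Orthonormal ℝ ((Set.range e).domRestrict v) := by
    rw [orthonormal_iff_ite]
    rintro ⟨_, i, rfl⟩ ⟨_, j, rfl⟩
    have h := congrFun (congrFun hV j) i
    simp only [Matrix.mul_apply, Matrix.transpose_apply, Matrix.one_apply] at h
    simp [hv, PiLp.inner_apply, h, Subtype.ext_iff, e.injective.eq_iff, eq_comm]
  obtain ⟨b, hb⟩ := hon.exists_orthonormalBasis_extension_of_card_eq (by simp)
  refine ⟨(EuclideanSpace.basisFun m ℝ).toBasis.toMatrix b,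
    OrthonormalBasis.toMatrix_orthonormalBasis_mem_orthogonal _ _, fun q j => ?_⟩
  simp [Module.Basis.toMatrix_apply, hb _ (Set.mem_range_self j), hv]

open scoped MatrixOrder in
/-- A contraction from `ℝ^n` to `ℝ^k` is a block of an orthogonal matrix. -/
theorem exists_orthogonal_dilation {k : Type*} [Fintype k] [DecidableEq k] [Fintype n]
    [DecidableEq n] (X : Matrix k n ℝ) (hX : ∀ x, (X *ᵥ x) ⬝ᵥ (X *ᵥ x) ≤ x ⬝ᵥ x) (e : n ↪ k) :
    ∃ U ∈ Matrix.orthogonalGroup (k ⊕ n) ℝ, ∀ i j, U (Sum.inl i) (Sum.inl (e j)) = X i j := by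
  have hpos : (1 - Xᵀ * X).PosSemidef := by
    refine .of_dotProduct_mulVec_nonneg ?_ fun x => ?_
    · simp [Matrix.IsHermitian, Matrix.conjTranspose_eq_transpose_of_trivial]
    · have h := hX x
      rw [Matrix.sub_mulVec, dotProduct_sub, Matrix.one_mulVec, ← Matrix.mulVec_mulVec,
        Matrix.dotProduct_mulVec (star x) Xᵀ, Matrix.vecMul_transpose]
      simpa using h
  -- With `Dᵀ * D = 1 - Xᵀ * X`, stacking `X` on `D` gives orthonormal columns, which extend to an
  -- orthonormal basis.
  obtain ⟨D, hD⟩ := CStarAlgebra.nonneg_iff_eq_star_mul_self.1 hpos.nonneg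
  obtain ⟨U, hU, h⟩ := exists_orthogonal_extension_of_isometry
    (e.trans ⟨Sum.inl, Sum.inl_injective⟩) (Matrix.fromRows X D) (by
      rw [Matrix.transpose_fromRows, Matrix.fromCols_mul_fromRows]
      rw [Matrix.star_eq_conjTranspose, Matrix.conjTranspose_eq_transpose_of_trivial] at hD
      rw [← hD]; abel)
  exact ⟨U, hU, fun i j => by simpa using h (Sum.inl i) j⟩

theorem map_ofReal_mem_unitaryGroup [Fintype n] [DecidableEq n] {U : Matrix n n ℝ}
    (hU : U ∈ Matrix.orthogonalGroup n ℝ) :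
    U.map Complex.ofReal ∈ Matrix.unitaryGroup n ℂ := by
  rw [Matrix.mem_unitaryGroup_iff']
  rw [Matrix.mem_orthogonalGroup_iff'] at hU
  have h := congrArg (fun M => M.map Complex.ofRealHom) hU
  simp only [Matrix.map_mul] at h
  ext i j
  have := congrFun (congrFun h i) j
  simpa [Matrix.mul_apply, Matrix.one_apply, Matrix.star_eq_conjTranspose] using this

end Dilation

/-! ### Simulating a chain by an end-decisive automaton -/

section Realization

variable {α S : Type*} [Fintype S]

/-- A real vector indexed by `S` as a complex state vector supported on the first summand. -/
def stateVector (φ : S → ℝ) : (S ⊕ Unit) ⊕ S → ℂ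
  | Sum.inl (Sum.inl j) => φ j
  | _ => 0

theorem mulVec_stateVector (V : Matrix ((S ⊕ Unit) ⊕ S) ((S ⊕ Unit) ⊕ S) ℝ)
    (X : Matrix (S ⊕ Unit) S ℝ)
    (hV : ∀ i j, V (Sum.inl i) (Sum.inl (Sum.inl j)) = X i j) (φ : S → ℝ) (i : S ⊕ Unit) :
    (V.map Complex.ofReal *ᵥ stateVector φ) (Sum.inl i) = ((X *ᵥ φ) i : ℝ) := by
  simp [Matrix.mulVec, dotProduct, stateVector, hV]

variable [DecidableEq S]

theorem step_some_stateVector (M : MMQFA α ((S ⊕ Unit) ⊕ S))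
    (hacc : M.acc = {Sum.inl (Sum.inr ())})
    (hrej : M.rej = Finset.univ.map ⟨Sum.inr, Sum.inr_injective⟩)
    (σ : α) (A : Matrix S S ℝ)
    (hU : ∀ φ i, ((M.U (some σ) : Matrix ((S ⊕ Unit) ⊕ S) ((S ⊕ Unit) ⊕ S) ℂ) *ᵥ
      stateVector φ) (Sum.inl i) =
      ((Matrix.fromRows Aᵀ (0 : Matrix Unit S ℝ) *ᵥ φ) i : ℝ)) (φ : S → ℝ) (r : ℝ) :
    ∃ r', M.step ⟨stateVector φ, 0, r⟩ (some σ) = ⟨stateVector (Aᵀ *ᵥ φ), 0, r'⟩ := by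
  refine ⟨(M.step ⟨stateVector φ, 0, r⟩ (some σ)).pRej, ?_⟩
  rw [MMQFA.step, MMQFA.Config.mk.injEq]
  refine ⟨?_, ?_, rfl⟩
  · funext q
    rcases q with (j | _) | j
    · simp [MMQFA.proj, MMQFA.non, hacc, hrej, hU, stateVector, Matrix.fromRows_mulVec]
    · simp [MMQFA.proj, MMQFA.non, hacc, stateVector]
    · simp [MMQFA.proj, MMQFA.non, hrej, stateVector]
  · simp [MMQFA.sqNorm, MMQFA.proj, hacc, hU, Matrix.fromRows_mulVec]

theorem pAcc_step_none_stateVector (M : MMQFA α ((S ⊕ Unit) ⊕ S))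
    (hacc : M.acc = {Sum.inl (Sum.inr ())}) (c : S → ℝ)
    (hU : ∀ φ i, ((M.U none : Matrix ((S ⊕ Unit) ⊕ S) ((S ⊕ Unit) ⊕ S) ℂ) *ᵥ
      stateVector φ) (Sum.inl i) =
      ((Matrix.fromRows (0 : Matrix S S ℝ) (Matrix.replicateRow Unit c) *ᵥ φ) i : ℝ))
    (φ : S → ℝ) (r : ℝ) :
    (M.step ⟨stateVector φ, 0, r⟩ none).pAcc = (φ ⬝ᵥ c) ^ 2 := by
  have h : (Matrix.replicateRow Unit c *ᵥ φ) () = φ ⬝ᵥ c := dotProduct_comm c φ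
  simp [MMQFA.step, MMQFA.sqNorm, MMQFA.proj, hacc, hU, h]

/-- A reward function with a reward vector of norm at most one is, up to squaring, the acceptance
probability of an end-decisive automaton. -/
theorem exists_endDecisive_acceptProb_eq (A : α → Matrix S S ℝ)
    (hA : ∀ σ, A σ ∈ doublyStochastic ℝ S) (c : S → ℝ) (hc : c ⬝ᵥ c ≤ 1) (s : S) :
    ∃ M : MMQFA α ((S ⊕ Unit) ⊕ S), M.EndDecisive ∧
      ∀ w, M.acceptProb w = expectedReward A c w s ^ 2 := by
  -- Amplitudes evolve like distributions, hence the transpose. The zero row feeds nothing into the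
  -- accepting state before the end-marker.
  have hsome : ∀ σ, ∃ V ∈ Matrix.orthogonalGroup ((S ⊕ Unit) ⊕ S) ℝ, ∀ i j,
      V (Sum.inl i) (Sum.inl (Sum.inl j)) =
        Matrix.fromRows (A σ)ᵀ (0 : Matrix Unit S ℝ) i j := fun σ =>
    exists_orthogonal_dilation _ (fun x => by
      have := dotProduct_mulVec_self_le_of_mem_doublyStochastic
        (transpose_mem_doublyStochastic_iff.2 (hA σ)) x
      simpa [Matrix.fromRows_mulVec, dotProduct] using this) ⟨Sum.inl, Sum.inl_injective⟩
  obtain ⟨W, hW, hWX⟩ := exists_orthogonal_dilation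
    (Matrix.fromRows (0 : Matrix S S ℝ) (Matrix.replicateRow Unit c)) (fun x => by
      have h1 := Finset.sum_mul_sq_le_sq_mul_sq Finset.univ c x
      have h2 : (c ⬝ᵥ x) * (c ⬝ᵥ x) ≤ x ⬝ᵥ x := by
        have h3 : 0 ≤ x ⬝ᵥ x := Finset.sum_nonneg fun i _ => mul_self_nonneg _
        simp only [dotProduct, sq] at *
        nlinarith
      simpa [Matrix.fromRows_mulVec, dotProduct, Matrix.mulVec] using h2)
    ⟨Sum.inl, Sum.inl_injective⟩
  choose V hV hVX using hsome
  let M : MMQFA α ((S ⊕ Unit) ⊕ S) :=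
    { U := fun t => t.elim ⟨_, map_ofReal_mem_unitaryGroup hW⟩
        fun σ => ⟨_, map_ofReal_mem_unitaryGroup (hV σ)⟩
      q₀ := Sum.inl (Sum.inl s)
      acc := {Sum.inl (Sum.inr ())}
      rej := Finset.univ.map ⟨Sum.inr, Sum.inr_injective⟩
      disjoint_acc_rej := by simp }
  have hstep : ∀ σ φ r, ∃ r', M.step ⟨stateVector φ, 0, r⟩ (some σ) =
      ⟨stateVector ((A σ)ᵀ *ᵥ φ), 0, r'⟩ := fun σ =>
    step_some_stateVector M rfl rfl σ (A σ) fun φ i => mulVec_stateVector _ _ (hVX σ) φ i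
  -- Moving each matrix across the pairing turns forward evolution of amplitudes into the backward
  -- recursion for rewards.
  have hrun : ∀ (w : List α) (φ : S → ℝ) (r : ℝ), ∃ ψ r',
      (w.map some).foldl M.step ⟨stateVector φ, 0, r⟩ = ⟨stateVector ψ, 0, r'⟩ ∧
        ψ ⬝ᵥ c = φ ⬝ᵥ expectedReward A c w := by
    intro w
    induction w with
    | nil => exact fun φ r => ⟨φ, r, rfl, rfl⟩
    | cons σ w ih =>
      intro φ r
      obtain ⟨r', h⟩ := hstep σ φ r
      obtain ⟨ψ, r'', h1, h2⟩ := ih ((A σ)ᵀ *ᵥ φ) r'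
      refine ⟨ψ, r'', by rw [List.map_cons, List.foldl_cons, h, h1], ?_⟩
      rw [h2, expectedReward, Matrix.dotProduct_mulVec, Matrix.mulVec_transpose]
  have hinit : M.init = ⟨stateVector (Pi.single s 1), 0, 0⟩ := by
    rw [MMQFA.init, MMQFA.Config.mk.injEq]
    refine ⟨funext fun q => ?_, rfl, rfl⟩
    rcases q with (j | _) | j <;> simp [stateVector, M, Pi.single_apply, apply_ite]
  refine ⟨M, fun w => ?_, fun w => ?_⟩
  · obtain ⟨ψ, r', h, -⟩ := hrun w (Pi.single s 1) 0
    rw [MMQFA.run, hinit, h]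
  · obtain ⟨ψ, r', h, h'⟩ := hrun w (Pi.single s 1) 0
    rw [MMQFA.acceptProb, MMQFA.run, hinit, List.foldl_append, h, List.foldl_cons, List.foldl_nil,
      pAcc_step_none_stateVector M rfl c (fun φ i => mulVec_stateVector _ _ hWX φ i), h']
    simp

end Realization

theorem mainTheorem2 {α : Type*} [Fintype α] (L : Set (List α)) (hL : IsPiecewiseTestable L) :
    ∃ (Q : Type) (_ : Fintype Q) (_ : DecidableEq Q) (M : MMQFA α Q),
      M.EndDecisive ∧ M.AcceptsWithBoundedError L := by
  obtain ⟨f, hf, happ⟩ := hL.isRewardApproximable (1 / 8) (by norm_num)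
  -- The shift by 2 keeps the reward positive, so that squaring preserves order.
  obtain ⟨S, _, _, A, c, s, hA, hfc⟩ := hf.add (.const 2)
  have hcc : 0 ≤ c ⬝ᵥ c := Finset.sum_nonneg fun i _ => mul_self_nonneg _
  obtain ⟨κ, hκ, hκ3, hκc⟩ : ∃ κ : ℝ, 0 < κ ∧ κ ≤ 1 / 3 ∧ κ * (c ⬝ᵥ c) ≤ 1 := by
    refine ⟨(3 + c ⬝ᵥ c)⁻¹, by positivity, ?_, ?_⟩
    · rw [one_div]
      exact inv_anti₀ (by norm_num) (by linarith)
    · rw [inv_mul_le_one₀ (by positivity)]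
      linarith
  have hnorm : (κ • c) ⬝ᵥ (κ • c) ≤ 1 := by
    rw [smul_dotProduct, dotProduct_smul, smul_eq_mul, smul_eq_mul]
    nlinarith
  obtain ⟨M, hM, hprob⟩ := exists_endDecisive_acceptProb_eq A hA (κ • c) hnorm s
  have hprob' : ∀ w, M.acceptProb w = κ ^ 2 * (f w + 2) ^ 2 := fun w => by
    rw [hprob, expectedReward_smul, Pi.smul_apply, ← hfc, smul_eq_mul, mul_pow]
  have hκ2 : 0 < κ ^ 2 := by positivity
  -- The cut-point is `κ² (5/2)²`, at most 1 since `κ ≤ 1/3`. The shifted reward is at least 23/8 on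
  -- `L` and at most 17/8 off it, with squares above 29/4 and below 21/4.
  refine ⟨_, inferInstance, inferInstance, M, hM, κ ^ 2 * (25 / 4), ⟨by positivity, by nlinarith⟩,
    κ ^ 2, hκ2, fun w hw => ?_, fun w hw => ?_⟩
  · have h := abs_le.1 (happ w)
    rw [if_pos hw] at h
    rw [hprob', ← mul_add_one]
    exact mul_lt_mul_of_pos_left (by nlinarith) hκ2
  · have h := abs_le.1 (happ w)
    rw [if_neg hw] at h
    rw [hprob', ← mul_sub_one]
    exact mul_lt_mul_of_pos_left (by nlinarith) hκ2
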